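/- Let $d\in\mathbb{N}$ and $0<\beta\le 1$. For $\rho>0$ put $E_{\beta,\rho}(z)=\sum_{n\ge 0} z^n/\Gamma(\beta n+\rho)$ and $E_\beta=E_{\beta,1}$. Let $\mu_\beta$ be the Mittag-Leffler measure, i.e. the probability measure on the cylinder $\sigma$-algebra of the space $\mathcal{S}'(\mathbb{R})$ of real tempered distributions with $$\int_{\mathcal{S}'(\mathbb{R})} e^{i\langle\omega,\varphi\rangle}\,d\mu_\beta(\omega)=E_\beta\big(-\tfrac12\langle\varphi,\varphi\rangle\big),\qquad \varphi\in\mathcal{S}(\mathbb{R}),$$ and let $\mu_\beta^{\otimes d}$ be its $d$-fold product on $\mathcal{S}_d'(\mathbb{R})=\mathcal{S}'(\mathbb{R})^d$. Let $\mathcal{S}_d(\mathbb{R})=\mathcal{S}(\mathbb{R})^d$, with complexification $\mathcal{S}_d(\mathbb{R})_{\mathbb{C}}=\mathcal{S}(\mathbb{R};\mathbb{C})^d$, and write $\langle\omega,\varphi\rangle=\sum_{k=1}^d\langle\omega_k,\varphi_k\rangle$ for the dual pairing, extended $\mathbb{C}$-linearly in $\varphi$; all pairings of functions, $\langle f,g\rangle=\int_{\mathbb{R}}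 f(x)g(x)\,dx$, are bilinear. For $\eta=(\eta_1,\dots,\eta_d)\in L^2_d(\mathbb{R})=L^2(\mathbb{R};\mathbb{R}^d)$ let $\langle\cdot,\eta\rangle$ be the limit in $L^2(\mu_\beta^{\otimes d})$ of $\langle\cdot,\varphi_n\rangle$, where $\varphi_n\in\mathcal{S}_d(\mathbb{R})$ and $\varphi_n\to\eta$ in $L^2_d(\mathbb{R})$ (this limit exists and does not depend on the sequence), and let $G(\cdot,\eta)=(\langle\cdot,\eta_1\mathbf{e}_1\rangle,\dots,\langle\cdot,\eta_d\mathbf{e}_d\rangle)$, where $\mathbf{e}_1,\dots,\mathbf{e}_d$ is the canonical basis of $\mathbb{R}^d$. For $F\in L^2(\mu_\beta^{\otimes d})$ the $S$-transform is $$SF(\varphi)=\int_{\mathcal{S}_d'(\mathbb{R})}F(\omega)\,\frac{e^{\langle\omega,\varphi\rangle}}{l(\varphi)}\,d\mu_\beta^{\otimes d}(\omega),\qquad l(\varphi)=\int_{\mathcal{S}_d'(\mathbb{R})} e^{\langle\omega,\varphi\rangle}\,d\mu_\beta^{\otimes d}(\omega),$$ and the $S$-transform of a random vector is taken componentwise.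 Then there is a neighborhood $\mathcal{U}_0$ of zero in $\mathcal{S}_d(\mathbb{R})_{\mathbb{C}}$ such that, for all $\varphi\in\mathcal{U}_0$, one has $l(\varphi)\neq 0$, $e^{\langle\cdot,\varphi\rangle}/l(\varphi)\in L^2(\mu_\beta^{\otimes d})$ and $E_\beta(\tfrac12\langle\varphi_k,\varphi_k\rangle)\ne 0$ for $k=1,\dots,d$, and such that, for all $\eta\in L^2_d(\mathbb{R})$ and $\varphi\in\mathcal{U}_0$, $$S\langle\cdot,\eta\rangle(\varphi)=\sum_{k=1}^d\frac{E_{\beta,\beta}\big(\frac12\langle\varphi_k,\varphi_k\rangle\big)}{\beta\,E_\beta\big(\frac12\langle\varphi_k,\varphi_k\rangle\big)}\langle\varphi_k,\eta_k\rangle,\qquad S\,G(\cdot,\eta)(\varphi)=\sum_{k=1}^d\frac{E_{\beta,\beta}\big(\frac12\langle\varphi_k,\varphi_k\rangle\big)}{\beta\,E_\beta\big(\frac12\langle\varphi_k,\varphi_k\rangle\big)}\langle\varphi_k,\eta_k\rangle\,\mathbf{e}_k.$$ -/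

import Mathlib

open MeasureTheory Filter Topology
open scoped SchwartzMap ENNReal

noncomputable section

namespace MittagLefflerAnalysis

/-- The generalized Mittag-Leffler function
`E_{β,ρ}(z) = ∑ n, z ^ n / Γ(β n + ρ)`. -/
def mittagLeffler₂ (β ρ : ℝ) (z : ℂ) : ℂ :=
  ∑' n : ℕ, z ^ n / (Real.Gamma (β * n + ρ) : ℂ)

/-- The Mittag-Leffler function `E_β(z) = ∑ n, z ^ n / Γ(β n + 1)`. -/
def mittagLeffler (β : ℝ) (z : ℂ) : ℂ :=
  ∑' n : ℕ, z ^ n / (Real.Gamma (β * n + 1) : ℂ)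

/-- The space `𝒮'(ℝ)` of real tempered distributions: continuous linear functionals
on the real Schwartz space. -/
abbrev RealTempered : Type := 𝓢(ℝ, ℝ) →L[ℝ] ℝ

/-- The cylinder σ-algebra on `𝒮'(ℝ)`: the smallest one that makes all the maps
`ω ↦ ⟨ω, φ⟩` with `φ ∈ 𝒮(ℝ)` Borel measurable. -/
instance instMeasurableSpaceRealTempered : MeasurableSpace RealTempered :=
  ⨆ φ : 𝓢(ℝ, ℝ), MeasurableSpace.comap (fun ω : RealTempered => ω φ) (borel ℝ)

/-- `μ` is the Mittag-Leffler measure `μ_β` on `𝒮'(ℝ)`: the probability measure on the cylinder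
σ-algebra with characteristic function `φ ↦ E_β(-½ ⟨φ, φ⟩)`. -/
structure IsMittagLefflerMeasure (β : ℝ) (μ : Measure RealTempered) : Prop where
  isProbabilityMeasure : IsProbabilityMeasure μ
  charFun_eq : ∀ φ : 𝓢(ℝ, ℝ),
    ∫ ω : RealTempered, Complex.exp (Complex.I * ((ω φ : ℝ) : ℂ)) ∂μ
      = mittagLeffler β (((-(1 / 2) * ∫ x : ℝ, φ x * φ x : ℝ)) : ℂ)

/-- `𝒮_d'(ℝ)`, identified with `𝒮'(ℝ)^d`; it carries the product σ-algebra. -/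
abbrev RealTemperedVec (d : ℕ) : Type := Fin d → RealTempered

/-- The `d`-fold product measure `μ^{⊗d}` on `𝒮_d'(ℝ)`. -/
def prodMeasure (d : ℕ) (μ : Measure RealTempered) : Measure (RealTemperedVec d) :=
  Measure.pi fun _ : Fin d => μ

/-- `𝒮_d(ℝ)`, the direct sum of `d` copies of `𝒮(ℝ)`. -/
abbrev SchwartzVec (d : ℕ) : Type := Fin d → 𝓢(ℝ, ℝ)

/-- The complexification of `𝒮_d(ℝ)`, that is, the direct sum of `d` copies of the space of
complex-valued Schwartz functions, with its usual topology. -/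
abbrev SchwartzVecC (d : ℕ) : Type := Fin d → 𝓢(ℝ, ℂ)

/-- The real Hilbert space `L²_d(ℝ) = L²(ℝ, dx; ℝ^d)`, as the Hilbert direct sum of `d` copies
of `L²(ℝ)`; its norm satisfies `‖η‖² = ∑ k, ‖η_k‖²`. -/
abbrev L2Vec (d : ℕ) : Type := PiLp 2 fun _ : Fin d => Lp ℝ 2 (volume : Measure ℝ)

/-- The inclusion of `𝒮_d(ℝ)` into `L²_d(ℝ)`. -/
def schwartzToL2 {d : ℕ} (φ : SchwartzVec d) : L2Vec d :=
  WithLp.toLp 2 fun k => (φ k).toLp 2 volume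

/-- The element `f 𝐞_k` of `L²_d(ℝ)`, for `f ∈ L²(ℝ)`. -/
def l2Single {d : ℕ} (k : Fin d) (f : Lp ℝ 2 (volume : Measure ℝ)) : L2Vec d :=
  WithLp.toLp 2 (Pi.single k f)

/-- The dual pairing `⟨ω, φ⟩ = ∑ k, ⟨ω_k, φ_k⟩` for `φ ∈ 𝒮_d(ℝ)`. -/
def pairing {d : ℕ} (φ : SchwartzVec d) (ω : RealTemperedVec d) : ℝ :=
  ∑ k, ω k (φ k)

/-- The real part of a complex-valued Schwartz function. -/
def schwartzRe (f : 𝓢(ℝ, ℂ)) : 𝓢(ℝ, ℝ) := SchwartzMap.postcompCLM Complex.reCLM f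

/-- The imaginary part of a complex-valued Schwartz function. -/
def schwartzIm (f : 𝓢(ℝ, ℂ)) : 𝓢(ℝ, ℝ) := SchwartzMap.postcompCLM Complex.imCLM f

/-- The dual pairing extended complex linearly,
`⟨ω, φ¹ + i φ²⟩ = ⟨ω, φ¹⟩ + i ⟨ω, φ²⟩` for `φ¹ + i φ²` in the complexification of `𝒮_d(ℝ)`. -/
def pairingC {d : ℕ} (φ : SchwartzVecC d) (ω : RealTemperedVec d) : ℂ :=
  (pairing (fun k => schwartzRe (φ k)) ω : ℂ)
    + Complex.I * (pairing (fun k => schwartzIm (φ k)) ω : ℂ)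

/-- `X` is (a version of) the random variable `⟨·, η⟩` for `η ∈ L²_d(ℝ)`: it is square integrable,
and `⟨·, φ_n⟩` converges to it in `L²(μ^{⊗d})` whenever `φ_n ∈ 𝒮_d(ℝ)` converges to `η`
in `L²_d(ℝ)`. -/
def IsL2Pairing {d : ℕ} (μ : Measure RealTempered) (η : L2Vec d)
    (X : RealTemperedVec d → ℝ) : Prop :=
  MemLp X 2 (prodMeasure d μ) ∧
    ∀ φ : ℕ → SchwartzVec d, Tendsto (fun n => schwartzToL2 (φ n)) atTop (𝓝 η) →
      Tendsto (fun n => eLpNorm (fun ω => pairing (φ n) ω - X ω) 2 (prodMeasure d μ))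
        atTop (𝓝 0)

open Classical in
/-- The random variable `⟨·, η⟩` on `𝒮_d'(ℝ)` for `η ∈ L²_d(ℝ)`, the `L²(μ^{⊗d})` limit of
`⟨·, φ_n⟩` for `φ_n → η`; it is determined up to a null set. (The value `0` where no limit exists is
a default.) -/
def l2Pairing {d : ℕ} (μ : Measure RealTempered) (η : L2Vec d) : RealTemperedVec d → ℝ :=
  if h : ∃ X, IsL2Pairing μ η X then h.choose else 0

/-- The random vector `G(·, η) = (⟨·, η_1 𝐞_1⟩, …, ⟨·, η_d 𝐞_d⟩)`. -/
def randomVector {d : ℕ} (μ : Measure RealTempered) (η : L2Vec d) (ω : RealTemperedVec d) :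
    Fin d → ℝ :=
  fun k => l2Pairing μ (l2Single k (η k)) ω

/-- The Laplace transform `l(φ) = ∫ exp ⟨ω, φ⟩ dμ^{⊗d}(ω)`. -/
def laplace {d : ℕ} (μ : Measure RealTempered) (φ : SchwartzVecC d) : ℂ :=
  ∫ ω, Complex.exp (pairingC φ ω) ∂(prodMeasure d μ)

/-- The normalized exponential `e(φ; ω) = exp ⟨ω, φ⟩ / l(φ)`. -/
def normalizedExp {d : ℕ} (μ : Measure RealTempered) (φ : SchwartzVecC d)
    (ω : RealTemperedVec d) : ℂ :=
  Complex.exp (pairingC φ ω) / laplace μ φ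

/-- The dual pairing `⟪F, G⟫ = ∫ F G dμ^{⊗d}` of square integrable functions: the bilinear
(not sesquilinear) form of the scalar product of `L²(μ^{⊗d})`. -/
def dualPairing {d : ℕ} (μ : Measure RealTempered) (F G : RealTemperedVec d → ℂ) : ℂ :=
  ∫ ω, F ω * G ω ∂(prodMeasure d μ)

/-- The `S`-transform `S F(φ) = ⟪F, e(φ; ·)⟫` of a square integrable function `F`. -/
def sTransform {d : ℕ} (μ : Measure RealTempered) (F : RealTemperedVec d → ℂ)
    (φ : SchwartzVecC d) : ℂ :=
  dualPairing μ F (normalizedExp μ φ)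

/-- The `S`-transform of a random vector, taken componentwise. -/
def sTransformVec {d : ℕ} (μ : Measure RealTempered) (F : RealTemperedVec d → Fin d → ℂ)
    (φ : SchwartzVecC d) : Fin d → ℂ :=
  fun k => sTransform μ (fun ω => F ω k) φ

/-- The bilinear pairing `⟨f, f⟩ = ∫ f(x)² dx` (without complex conjugation). -/
def schwartzSelfPairing (f : 𝓢(ℝ, ℂ)) : ℂ := ∫ x : ℝ, f x * f x

/-- The bilinear pairing `⟨f, g⟩ = ∫ f(x) g(x) dx` of a complex Schwartz function with an
element of `L²(ℝ)`. -/
def schwartzL2Pairing (f : 𝓢(ℝ, ℂ)) (g : Lp ℝ 2 (volume : Measure ℝ)) : ℂ :=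
  ∫ x : ℝ, f x * (g x : ℂ)

/-- The coefficient `E_{β,β}(½⟨f, f⟩) / (β E_β(½⟨f, f⟩))`. -/
def sCoefficient (β : ℝ) (f : 𝓢(ℝ, ℂ)) : ℂ :=
  mittagLeffler₂ β β (schwartzSelfPairing f / 2)
    / ((β : ℂ) * mittagLeffler β (schwartzSelfPairing f / 2))

end MittagLefflerAnalysis

end

/-!
The `S`-transform of `⟨·, η⟩` is a logarithmic derivative of the Laplace transform `l` of the
product measure, and `l(φ) = ∏ k, E_β(½ ⟨φ_k, φ_k⟩)`.

The characteristic function of `μ_β` only prescribes `∫ exp (i t ⟨ω, ψ⟩)` for real `t`, so the first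
task is to produce exponential moments. For a real random variable `X` whose cosine transform is the
real part of an entire function `F`, Fatou's lemma applied to second symmetric difference
quotients gives the even moments one after the other as `± F^(2n)(0)`
(`integral_pow_mul_cos_of_entire`), and Cauchy's estimates on large circles make the series
`∑ a^(2n) E[X^(2n)] / (2n)!` converge, so `exp (a |X|)` is integrable for every `a`
(`integrable_exp_mul_abs_of_entire`). Since `Γ` grows superexponentially, `E_β` is entire, and this
applies to `X = ⟨·, ψ⟩`.

Integrals `∫ W exp (z X)` are then entire functions of `z` that may be differentiated under the
integral (`hasDerivAt_integral_mul_cexp`), and the identity theorem continues the characteristic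
function to `∫ exp ⟨ω, f⟩ = E_β(½ ⟨f, f⟩)` for all complex test functions `f`
(`integral_cexp_temperedApplyC`). Differentiating in a real direction `ψ` and using
`E_β' = E_{β,β} / β` (`hasDerivAt_mittagLeffler`) gives
`∫ ⟨ω, ψ⟩ exp ⟨ω, f⟩ = E_{β,β}(½ ⟨f, f⟩) / β * ⟨f, ψ⟩` (`integral_apply_mul_cexp_temperedApplyC`).

Fubini's theorem carries this to the product measure and proves the formula for test functions
(`sTransform_pairing`). The second moment of `⟨·, ψ⟩` is a constant times `‖ψ‖²`, so `⟨·, φ⟩`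
extends continuously to `η ∈ L²_d(ℝ)` (`exists_isL2Pairing`); both sides of the formula are continuous in
`η`, and the general case follows by density (`sTransform_l2Pairing`). The neighborhood of zero
consists of all `φ` at which no factor `E_β(½ ⟨φ_k, φ_k⟩)` vanishes, as exponential moments of
every order exist.
-/

noncomputable section

namespace MittagLefflerAnalysis

/-! ### The Mittag-Leffler function -/

/-- Restricting Euler's integral to `(R, ∞)` shows that `Γ` grows faster than any exponential. -/
theorem rpow_mul_exp_neg_le_Gamma_add_one {R x : ℝ} (hR : 0 < R) (hx : 0 ≤ x) :
    R ^ x * Real.exp (-R) ≤ Real.Gamma (x + 1) := by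
  have hint := Real.GammaIntegral_convergent (s := x + 1) (by linarith)
  rw [Real.Gamma_eq_integral (by linarith), ← integral_exp_neg_Ioi, ← integral_const_mul]
  have hsub : Set.Ioi R ⊆ Set.Ioi (0 : ℝ) := Set.Ioi_subset_Ioi hR.le
  calc ∫ t in Set.Ioi R, R ^ x * Real.exp (-t)
      ≤ ∫ t in Set.Ioi R, Real.exp (-t) * t ^ (x + 1 - 1) := by
        refine setIntegral_mono_on ((integrableOn_exp_neg_Ioi R).const_mul _)
          (hint.mono_set hsub) measurableSet_Ioi fun t ht => ?_
        rw [mul_comm, add_sub_cancel_right]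
        have : R ^ x ≤ t ^ x := Real.rpow_le_rpow hR.le (le_of_lt ht) hx
        gcongr
    _ ≤ _ := by
        refine setIntegral_mono_set hint ?_ hsub.eventuallyLE
        filter_upwards [self_mem_ae_restrict measurableSet_Ioi] with t ht
        have : (0 : ℝ) < t := ht
        positivity

theorem summable_pow_div_Gamma {β : ℝ} (hβ : 0 < β) (r : ℝ) (hr : 0 ≤ r) :
    Summable fun n : ℕ => r ^ n / Real.Gamma (β * n + 1) := by
  -- `R` is chosen so that `R ^ β = q`, which makes the terms at most `exp R * 2⁻ⁿ`
  set q : ℝ := 2 * r + 1 with hq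
  have hq0 : 0 < q := by positivity
  set R : ℝ := q ^ (1 / β) with hRdef
  have hR : 0 < R := Real.rpow_pos_of_pos hq0 _
  have hRq : ∀ n : ℕ, R ^ (β * n) = q ^ n := fun n => by
    rw [hRdef, ← Real.rpow_mul hq0.le, ← Real.rpow_natCast]
    congr 1
    field_simp
  have hgeo : Summable fun n : ℕ => Real.exp R * (1 / 2 : ℝ) ^ n :=
    (summable_geometric_of_lt_one (by norm_num) (by norm_num)).mul_left _
  refine Summable.of_nonneg_of_le (fun n => ?_) (fun n => ?_) hgeo
  · have : 0 < Real.Gamma (β * n + 1) := Real.Gamma_pos_of_pos (by positivity)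
    positivity
  · have h := rpow_mul_exp_neg_le_Gamma_add_one hR (x := β * n) (by positivity)
    rw [hRq] at h
    have hG : 0 < Real.Gamma (β * n + 1) := Real.Gamma_pos_of_pos (by positivity)
    rw [div_le_iff₀ hG]
    calc r ^ n ≤ ((1 / 2) * q) ^ n := by gcongr; linarith
      _ = Real.exp R * (1 / 2 : ℝ) ^ n * (q ^ n * Real.exp (-R)) := by
        rw [mul_pow, Real.exp_neg]
        field_simp
      _ ≤ _ := by gcongr

/-- `E_β` is entire and `E_β' = E_{β,β} / β`, by termwise differentiation and
`Γ(x + 1) = x Γ(x)`. -/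
theorem hasDerivAt_mittagLeffler {β : ℝ} (hβ : 0 < β) (z : ℂ) :
    HasDerivAt (mittagLeffler β) (mittagLeffler₂ β β z / β) z := by
  have hG : ∀ n : ℕ, 0 < Real.Gamma (β * n + 1) := fun n => Real.Gamma_pos_of_pos (by positivity)
  -- on the ball of radius `R ≥ 1` the crude bound `n ≤ 2 ^ n` dominates the differentiated series
  set R : ℝ := ‖z‖ + 1 with hR
  have hR1 : 1 ≤ R := by rw [hR]; linarith [norm_nonneg z]
  have hu : Summable fun n : ℕ => (2 * R) ^ n / Real.Gamma (β * n + 1) :=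
    summable_pow_div_Gamma hβ _ (by positivity)
  have hbound : ∀ (n : ℕ) (y : ℂ), y ∈ Metric.ball (0 : ℂ) R →
      ‖(n : ℂ) * y ^ (n - 1) / (Real.Gamma (β * n + 1) : ℂ)‖
        ≤ (2 * R) ^ n / Real.Gamma (β * n + 1) := by
    intro n y hy
    have hy' : ‖y‖ ≤ R := by simpa using (Metric.mem_ball.1 hy).le
    rw [norm_div, norm_mul, norm_pow, Complex.norm_natCast, Complex.norm_real,
      Real.norm_of_nonneg (hG n).le]
    have h1 : (n : ℝ) ≤ 2 ^ n := by exact_mod_cast n.lt_two_pow_self.le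
    have h2 : ‖y‖ ^ (n - 1) ≤ R ^ n :=
      (pow_le_pow_left₀ (norm_nonneg _) hy' _).trans (pow_le_pow_right₀ hR1 (Nat.sub_le _ _))
    have := hG n
    rw [mul_pow]
    gcongr
  have hz : z ∈ Metric.ball (0 : ℂ) R := by simp [hR]
  have hder := hasDerivAt_tsum_of_isPreconnected
    (g := fun (n : ℕ) (w : ℂ) => w ^ n / (Real.Gamma (β * n + 1) : ℂ))
    hu Metric.isOpen_ball (convex_ball (0 : ℂ) R).isPreconnected
    (fun n y _ => (hasDerivAt_pow n y).div_const _) hbound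
    (y₀ := 0) (by simp; linarith)
    (summable_of_ne_finset_zero (s := {0}) fun n hn => by
      have : n ≠ 0 := by simpa using hn
      simp [this]) hz
  suffices h : mittagLeffler₂ β β z / β
      = ∑' n : ℕ, (n : ℂ) * z ^ (n - 1) / (Real.Gamma (β * n + 1) : ℂ) by
    rw [h]; exact hder
  have hs : Summable fun n : ℕ => (n : ℂ) * z ^ (n - 1) / (Real.Gamma (β * n + 1) : ℂ) :=
    Summable.of_norm_bounded hu fun n => hbound n z hz
  rw [hs.tsum_eq_zero_add, mittagLeffler₂, ← tsum_div_const]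
  simp only [Nat.cast_zero, zero_mul, zero_div, zero_add]
  refine tsum_congr fun n => ?_
  have hn : β * ((n + 1 : ℕ) : ℝ) ≠ 0 := by positivity
  have hn' : ((n : ℂ) + 1) ≠ 0 := by exact_mod_cast n.succ_ne_zero
  have hβ' : (β : ℂ) ≠ 0 := by exact_mod_cast hβ.ne'
  rw [Real.Gamma_add_one hn]
  have e : β * ((n + 1 : ℕ) : ℝ) = β * n + β := by push_cast; ring
  have hg : (Real.Gamma (β * n + β) : ℂ) ≠ 0 := by
    exact_mod_cast (Real.Gamma_pos_of_pos (by positivity)).ne'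
  rw [e]
  push_cast
  have hb : (β * n + β : ℂ) ≠ 0 := by
    rw [show (β * n + β : ℂ) = β * (n + 1) by ring]
    exact mul_ne_zero hβ' hn'
  field_simp

theorem differentiable_mittagLeffler {β : ℝ} (hβ : 0 < β) : Differentiable ℂ (mittagLeffler β) :=
  fun z => (hasDerivAt_mittagLeffler hβ z).differentiableAt

theorem mittagLeffler_zero (β : ℝ) : mittagLeffler β 0 = 1 := by
  rw [mittagLeffler, tsum_eq_single 0 fun n hn => by simp [hn]]
  simp

/-! ### Exponential moments from an entire characteristic function -/

/-- The second symmetric difference quotient converges to the second derivative. -/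
theorem tendsto_second_symm_difference {g g' : ℝ → ℝ} {t c : ℝ}
    (hg : ∀ x, HasDerivAt g (g' x) x) (hg' : HasDerivAt g' c t) :
    Tendsto (fun h : ℝ => (g (t + h) + g (t - h) - 2 * g t) / h ^ 2) (𝓝[≠] 0) (𝓝 c) := by
  have hadd : ∀ h : ℝ, HasDerivAt (fun h : ℝ => t + h) 1 h := fun h => by
    simpa using (hasDerivAt_id h).const_add t
  have hsub : ∀ h : ℝ, HasDerivAt (fun h : ℝ => t - h) (-1) h := fun h => by
    simpa using (hasDerivAt_id h).const_sub t
  have hnum : ∀ h : ℝ, HasDerivAt (fun h : ℝ => g (t + h) + g (t - h) - 2 * g t)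
      (g' (t + h) - g' (t - h)) h := fun h => by
    have h1 := (hg (t + h)).comp h (hadd h)
    have h2 := (hg (t - h)).comp h (hsub h)
    have := (h1.add h2).sub_const (2 * g t)
    refine this.congr_deriv ?_
    ring
  have hden : ∀ h : ℝ, HasDerivAt (fun h : ℝ => h ^ 2) (2 * h) h := fun h => by
    simpa using hasDerivAt_pow 2 h
  refine HasDerivAt.lhopital_zero_nhdsNE (Eventually.of_forall hnum) (Eventually.of_forall hden)
    ?_ ?_ ?_ ?_
  · filter_upwards [self_mem_nhdsWithin] with h hh
    simpa using hh
  · have := (hnum 0).continuousAt.tendsto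
    simp only [add_zero, sub_zero] at this
    rw [show g t + g t - 2 * g t = 0 by ring] at this
    exact this.mono_left nhdsWithin_le_nhds
  · have := (hden 0).continuousAt.tendsto
    simp only [ne_eq, OfNat.ofNat_ne_zero, not_false_eq_true, zero_pow] at this
    exact this.mono_left nhdsWithin_le_nhds
  · have h0 : HasDerivAt (fun h : ℝ => g' (t + h) - g' (t - h)) (2 * c) 0 := by
      have h1 : HasDerivAt (fun h : ℝ => g' (t + h)) (c * 1) 0 :=
        HasDerivAt.comp (h₂ := g') 0 (by simpa using hg') (hadd 0)
      have h2 : HasDerivAt (fun h : ℝ => g' (t - h)) (c * (-1)) 0 :=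
        HasDerivAt.comp (h₂ := g') 0 (by simpa using hg') (hsub 0)
      refine (h1.sub h2).congr_deriv ?_
      ring
    have h3 := h0.tendsto_slope.const_mul (1 / 2)
    rw [show 1 / 2 * (2 * c) = c by ring] at h3
    refine h3.congr fun h => ?_
    simp only [slope_def_field, add_zero, sub_zero, sub_self]
    rw [div_mul_div_comm, one_mul]

theorem second_difference_cos (x t h : ℝ) :
    Real.cos ((t + h) * x) + Real.cos ((t - h) * x) - 2 * Real.cos (t * x)
      = -(Real.cos (t * x) * (2 * (1 - Real.cos (h * x)))) := by
  rw [add_mul, sub_mul, Real.cos_add, Real.cos_sub]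
  ring

theorem abs_second_difference_cos_div_le (x t h : ℝ) :
    |(Real.cos ((t + h) * x) + Real.cos ((t - h) * x) - 2 * Real.cos (t * x)) / h ^ 2| ≤ x ^ 2 := by
  rcases eq_or_ne h 0 with rfl | hh
  · simpa using sq_nonneg x
  have h1 : 0 ≤ 2 * (1 - Real.cos (h * x)) := by linarith [Real.cos_le_one (h * x)]
  have h2 : 2 * (1 - Real.cos (h * x)) ≤ x ^ 2 * h ^ 2 := by
    have := Real.one_sub_sq_div_two_le_cos (x := h * x)
    nlinarith
  have hpos : 0 < h ^ 2 := by positivity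
  rw [second_difference_cos, abs_div, abs_neg, abs_mul, abs_of_nonneg h1, abs_of_pos hpos,
    div_le_iff₀ hpos]
  calc |Real.cos (t * x)| * (2 * (1 - Real.cos (h * x)))
      ≤ 1 * (2 * (1 - Real.cos (h * x))) :=
        mul_le_mul_of_nonneg_right (Real.abs_cos_le_one _) h1
    _ ≤ _ := by linarith

theorem tendsto_second_difference_cos (x t : ℝ) :
    Tendsto (fun h : ℝ =>
      (Real.cos ((t + h) * x) + Real.cos ((t - h) * x) - 2 * Real.cos (t * x)) / h ^ 2)
      (𝓝[≠] 0) (𝓝 (-(x ^ 2 * Real.cos (t * x)))) := by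
  have hlin : ∀ s : ℝ, HasDerivAt (fun s : ℝ => s * x) x s := fun s => by
    simpa using (hasDerivAt_id s).mul_const x
  have h1 : ∀ s : ℝ, HasDerivAt (fun s : ℝ => Real.cos (s * x)) (-Real.sin (s * x) * x) s :=
    fun s => (hlin s).cos
  have h2 : HasDerivAt (fun s : ℝ => -Real.sin (s * x) * x) (-(x ^ 2 * Real.cos (t * x))) t := by
    refine ((hlin t).sin.neg.mul_const x).congr_deriv ?_
    ring
  exact tendsto_second_symm_difference (g := fun s => Real.cos (s * x)) h1 h2

section ExponentialMoments

variable {Ω : Type*} {mΩ : MeasurableSpace Ω} {ν : Measure Ω}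

/-- Two derivatives of the cosine transform of a positive weight `W` exist only if the second
moment is finite (Fatou's lemma), and then they may be taken under the integral sign. -/
theorem integrable_mul_sq_of_cos_transform {W X : Ω → ℝ} (hX : Measurable X)
    (hW : Integrable W ν) (hW0 : ∀ ω, 0 ≤ W ω) {g g' g'' : ℝ → ℝ}
    (hg : ∀ x, HasDerivAt g (g' x) x) (hg' : ∀ x, HasDerivAt g' (g'' x) x)
    (hcos : ∀ t, ∫ ω, W ω * Real.cos (t * X ω) ∂ν = g t) :
    Integrable (fun ω => W ω * X ω ^ 2) ν ∧
      ∀ t, ∫ ω, W ω * X ω ^ 2 * Real.cos (t * X ω) ∂ν = -g'' t := by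
  have hint : ∀ t, Integrable (fun ω => W ω * Real.cos (t * X ω)) ν := fun t =>
    hW.mul_bdd (c := 1) (by fun_prop) (Eventually.of_forall fun ω => by
      simpa using Real.abs_cos_le_one _)
  set D : ℝ → ℝ → Ω → ℝ := fun t h ω => W ω *
    ((Real.cos ((t + h) * X ω) + Real.cos ((t - h) * X ω) - 2 * Real.cos (t * X ω)) / h ^ 2)
    with hD
  have hD' : ∀ t h, D t h = fun ω => (W ω * Real.cos ((t + h) * X ω)
      + W ω * Real.cos ((t - h) * X ω) - 2 * (W ω * Real.cos (t * X ω))) / h ^ 2 := by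
    intro t h; ext ω; simp only [hD]; ring
  have hDint : ∀ t h, Integrable (D t h) ν := fun t h => by
    rw [hD']
    exact (((hint _).add (hint _)).sub ((hint _).const_mul 2)).div_const _
  have hDval : ∀ t h, ∫ ω, D t h ω ∂ν = (g (t + h) + g (t - h) - 2 * g t) / h ^ 2 := fun t h => by
    have h1 := integral_sub ((hint (t + h)).add (hint (t - h))) ((hint t).const_mul 2)
    simp only [Pi.add_apply] at h1
    rw [hD', integral_div, h1, integral_add (hint _) (hint _), integral_const_mul, hcos, hcos,
      hcos]
  -- a sequence of increments tending to zero
  set u : ℕ → ℝ := fun n => 1 / ((n : ℝ) + 1) with hu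
  have hu0 : Tendsto u atTop (𝓝[≠] 0) :=
    tendsto_nhdsWithin_iff.2 ⟨tendsto_one_div_add_atTop_nhds_zero_nat,
      Eventually.of_forall fun n => by
        simp only [hu, Set.mem_compl_iff, Set.mem_singleton_iff]
        positivity⟩
  have hlim : ∀ t, Tendsto (fun n => ∫ ω, D t (u n) ω ∂ν) atTop (𝓝 (g'' t)) := fun t => by
    simp only [hDval]
    exact (tendsto_second_symm_difference hg (hg' t)).comp hu0
  have hptw : ∀ t ω, Tendsto (fun n => D t (u n) ω) atTop
      (𝓝 (W ω * -(X ω ^ 2 * Real.cos (t * X ω)))) := fun t ω =>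
    ((tendsto_second_difference_cos (X ω) t).comp hu0).const_mul _
  have hmeas : AEStronglyMeasurable (fun ω => W ω * X ω ^ 2) ν :=
    hW.aestronglyMeasurable.mul (by fun_prop)
  have hsq : Integrable (fun ω => W ω * X ω ^ 2) ν := by
    refine ⟨hmeas, ?_⟩
    have hlimω : ∀ ω, Tendsto (fun n => ‖-D 0 (u n) ω‖ₑ) atTop (𝓝 ‖W ω * X ω ^ 2‖ₑ) := fun ω => by
      simpa using (hptw 0 ω).neg.enorm
    have hfatou := lintegral_liminf_le' (μ := ν) (u := atTop)
      (f := fun n ω => ‖-D 0 (u n) ω‖ₑ) fun n => (hDint 0 (u n)).neg.aestronglyMeasurable.enorm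
    simp only [(hlimω _).liminf_eq] at hfatou
    have hnn : ∀ n ω, 0 ≤ -D 0 (u n) ω := fun n ω => by
      simp only [hD]
      rw [second_difference_cos, ← mul_neg, ← neg_div, neg_neg]
      have := Real.cos_le_one (u n * X ω)
      have h1 : 0 ≤ 2 * (1 - Real.cos (u n * X ω)) := by linarith
      have := hW0 ω
      simp only [zero_mul, Real.cos_zero, one_mul]
      positivity
    have heq : ∀ n, ∫⁻ ω, ‖-D 0 (u n) ω‖ₑ ∂ν = ENNReal.ofReal (-∫ ω, D 0 (u n) ω ∂ν) := by
      intro n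
      have hneg : Integrable (fun ω => -D 0 (u n) ω) ν := (hDint 0 (u n)).neg
      rw [← integral_neg, ofReal_integral_eq_lintegral_ofReal hneg (Eventually.of_forall (hnn n))]
      refine lintegral_congr fun ω => ?_
      rw [Real.enorm_eq_ofReal (hnn n ω)]
    simp only [heq] at hfatou
    rw [(ENNReal.tendsto_ofReal (hlim 0).neg).liminf_eq] at hfatou
    exact hfatou.trans_lt ENNReal.ofReal_lt_top
  refine ⟨hsq, fun t => ?_⟩
  -- `W X²` dominates the difference quotients uniformly in the increment
  have hdct := tendsto_integral_of_dominated_convergence (fun ω => W ω * X ω ^ 2)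
    (fun n => (hDint t (u n)).aestronglyMeasurable) hsq
    (fun n => Eventually.of_forall fun ω => by
      simp only [hD]
      rw [norm_mul, Real.norm_of_nonneg (hW0 ω)]
      exact mul_le_mul_of_nonneg_left (abs_second_difference_cos_div_le _ _ _) (hW0 ω))
    (Eventually.of_forall (hptw t))
  have := tendsto_nhds_unique hdct (hlim t)
  rw [← this, ← integral_neg]
  refine integral_congr_ae (Eventually.of_forall fun ω => ?_)
  simp only
  ring

/-- If the cosine transform of `X` extends to an entire function `F`, all even moments of `X` are
finite and are given by the even derivatives of `F`. -/
theorem integral_pow_mul_cos_of_entire [IsFiniteMeasure ν] {X : Ω → ℝ} (hX : Measurable X)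
    {F : ℂ → ℂ} (hF : Differentiable ℂ F)
    (hcos : ∀ t : ℝ, ∫ ω, Real.cos (t * X ω) ∂ν = (F t).re) (n : ℕ) :
    Integrable (fun ω => X ω ^ (2 * n)) ν ∧
      ∀ t : ℝ, ∫ ω, X ω ^ (2 * n) * Real.cos (t * X ω) ∂ν
        = (-1) ^ n * (iteratedDeriv (2 * n) F t).re := by
  have hd : ∀ (k : ℕ) (x : ℝ), HasDerivAt (fun y : ℝ => (iteratedDeriv k F y).re)
      (iteratedDeriv (k + 1) F x).re x := fun k x => by
    have h1 : Differentiable ℂ (iteratedDeriv k F) :=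
      (hF.contDiff (n := (⊤ : ℕ∞))).differentiable_iteratedDeriv k
        (by exact_mod_cast ENat.natCast_lt_top k)
    have h2 := (h1 (x : ℂ)).hasDerivAt
    rw [← iteratedDeriv_succ] at h2
    exact h2.real_of_complex
  induction n with
  | zero => simpa using hcos
  | succ n ih =>
    obtain ⟨hi, hv⟩ := ih
    have := integrable_mul_sq_of_cos_transform hX hi
      (fun ω => by rw [pow_mul]; positivity)
      (fun x => (hd (2 * n) x).const_mul ((-1) ^ n))
      (fun x => (hd (2 * n + 1) x).const_mul ((-1) ^ n)) hv
    refine ⟨?_, fun t => ?_⟩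
    · simpa only [mul_add, mul_one, pow_add] using this.1
    · have h := this.2 t
      simp only [← pow_add] at h
      rw [pow_succ (-1 : ℝ), mul_neg_one, neg_mul]
      exact h

/-- A random variable whose cosine transform extends to an entire function has all exponential
moments: Cauchy's estimates on large circles control the moments. -/
theorem integrable_exp_mul_abs_of_entire [IsFiniteMeasure ν] {X : Ω → ℝ} (hX : Measurable X)
    {F : ℂ → ℂ} (hF : Differentiable ℂ F)
    (hcos : ∀ t : ℝ, ∫ ω, Real.cos (t * X ω) ∂ν = (F t).re) (a : ℝ) :
    Integrable (fun ω => Real.exp (a * |X ω|)) ν := by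
  have hmom := integral_pow_mul_cos_of_entire hX hF hcos
  -- a radius above `2 |a|` makes the series of moments converge geometrically
  set R : ℝ := 2 * |a| + 1 with hR
  have hR0 : 0 < R := by positivity
  obtain ⟨C, hC⟩ := (isCompact_sphere (0 : ℂ) R).exists_bound_of_continuousOn
    hF.continuous.continuousOn
  have hC0 : 0 ≤ C := (norm_nonneg _).trans (hC R (by simp [hR0.le]))
  have hm : ∀ n : ℕ, ∫ ω, X ω ^ (2 * n) ∂ν ≤ (2 * n).factorial * C / R ^ (2 * n) := fun n => by
    have h1 := (hmom n).2 0
    simp only [zero_mul, Real.cos_zero, mul_one, Complex.ofReal_zero] at h1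
    calc ∫ ω, X ω ^ (2 * n) ∂ν ≤ |(-1) ^ n * (iteratedDeriv (2 * n) F 0).re| := by
          rw [h1]; exact le_abs_self _
      _ ≤ ‖iteratedDeriv (2 * n) F 0‖ := by
          rw [abs_mul, abs_pow, abs_neg, abs_one, one_pow, one_mul]
          exact Complex.abs_re_le_norm _
      _ ≤ _ := Complex.norm_iteratedDeriv_le_of_forall_mem_sphere_norm_le _ hR0
          hF.diffContOnCl hC
  have hcosh : Integrable (fun ω => Real.cosh (a * X ω)) ν := by
    refine ⟨by fun_prop, ?_⟩
    have hterm : ∀ ω, ‖Real.cosh (a * X ω)‖ₑ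
        = ∑' n : ℕ, ENNReal.ofReal ((a * X ω) ^ (2 * n) / (2 * n).factorial) := fun ω => by
      rw [Real.enorm_eq_ofReal (Real.cosh_pos _).le, Real.cosh_eq_tsum,
        ENNReal.ofReal_tsum_of_nonneg (fun n => by rw [pow_mul]; positivity)
          (Real.hasSum_cosh _).summable]
    rw [HasFiniteIntegral]
    simp only [hterm]
    rw [lintegral_tsum fun n => by fun_prop]
    have hle : ∀ n : ℕ, ∫⁻ ω, ENNReal.ofReal ((a * X ω) ^ (2 * n) / (2 * n).factorial) ∂ν
        ≤ ENNReal.ofReal (C * (1 / 4) ^ n) := fun n => by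
      have hi : Integrable (fun ω => (a * X ω) ^ (2 * n) / ((2 * n).factorial : ℝ)) ν := by
        simp only [mul_pow]
        exact ((hmom n).1.const_mul _).div_const _
      rw [← ofReal_integral_eq_lintegral_ofReal hi
        (Eventually.of_forall fun ω => by simp only [Pi.zero_apply]; rw [pow_mul]; positivity)]
      refine ENNReal.ofReal_le_ofReal ?_
      simp only [mul_pow]
      rw [integral_div, integral_const_mul]
      have hf : (0 : ℝ) < (2 * n).factorial := by positivity
      have ha : |a| ≤ R / 2 := by rw [hR]; linarith
      calc a ^ (2 * n) * (∫ ω, X ω ^ (2 * n) ∂ν) / (2 * n).factorial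
          ≤ (R / 2) ^ (2 * n) * ((2 * n).factorial * C / R ^ (2 * n)) / (2 * n).factorial := by
            have h2 : a ^ (2 * n) ≤ (R / 2) ^ (2 * n) := by
              rw [← (even_two_mul n).pow_abs]; gcongr
            have h3 : 0 ≤ a ^ (2 * n) := (even_two_mul n).pow_nonneg a
            have h4 := hm n
            have h5 : 0 ≤ ∫ ω, X ω ^ (2 * n) ∂ν :=
              integral_nonneg fun ω => (even_two_mul n).pow_nonneg _
            have : 0 ≤ (2 * n).factorial * C / R ^ (2 * n) := by positivity
            gcongr
        _ = C * (1 / 4) ^ n := by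
            rw [div_pow, pow_mul (2 : ℝ) 2 n, div_pow, one_pow]
            norm_num
            field_simp
    refine (ENNReal.tsum_le_tsum hle).trans_lt ?_
    rw [← ENNReal.ofReal_tsum_of_nonneg (fun n => by positivity)
      ((summable_geometric_of_lt_one (by norm_num) (by norm_num)).mul_left C)]
    exact ENNReal.ofReal_lt_top
  refine (hcosh.const_mul 2).mono' (by fun_prop) (Eventually.of_forall fun ω => ?_)
  rw [Real.norm_of_nonneg (Real.exp_pos _).le]
  calc Real.exp (a * |X ω|) ≤ Real.exp |a * X ω| := by
        rw [abs_mul]; gcongr; exact le_abs_self a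
    _ ≤ Real.exp (a * X ω) + Real.exp (-(a * X ω)) := Real.exp_abs_le _
    _ = 2 * Real.cosh (a * X ω) := by rw [Real.cosh_eq]; ring

/-- The weighted complex moment generating function `z ↦ ∫ W exp (z Y)` is entire as soon as
`‖W‖ exp (a |Y|)` is integrable for every `a`, and may be differentiated under the integral. -/
theorem hasDerivAt_integral_mul_cexp {W : Ω → ℂ} {Y : Ω → ℝ}
    (hW : AEStronglyMeasurable W ν) (hY : Measurable Y)
    (hint : ∀ a : ℝ, Integrable (fun ω => ‖W ω‖ * Real.exp (a * |Y ω|)) ν) (z : ℂ) :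
    HasDerivAt (fun z : ℂ => ∫ ω, W ω * Complex.exp (z * Y ω) ∂ν)
      (∫ ω, W ω * (Y ω * Complex.exp (z * Y ω)) ∂ν) z := by
  have hexp : ∀ (w : ℂ) (r : ℝ), ‖w‖ ≤ r → ∀ ω, ‖Complex.exp (w * Y ω)‖ ≤ Real.exp (r * |Y ω|) := by
    intro w r hw ω
    rw [Complex.norm_exp]
    gcongr
    calc (w * Y ω).re ≤ ‖w * (Y ω : ℂ)‖ := Complex.re_le_norm _
      _ = ‖w‖ * |Y ω| := by rw [norm_mul, Complex.norm_real, Real.norm_eq_abs]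
      _ ≤ _ := by gcongr
  have hmeas : ∀ w : ℂ, AEStronglyMeasurable (fun ω => W ω * Complex.exp (w * Y ω)) ν := fun w =>
    hW.mul (by fun_prop)
  refine (hasDerivAt_integral_of_dominated_loc_of_deriv_le (Metric.ball_mem_nhds z one_pos)
    (bound := fun ω => ‖W ω‖ * Real.exp ((‖z‖ + 2) * |Y ω|))
    (F' := fun w ω => W ω * (Y ω * Complex.exp (w * Y ω)))
    (Eventually.of_forall hmeas) ?_ (hW.mul (by fun_prop)) ?_ (hint _) ?_).2
  · refine (hint ‖z‖).mono' (hmeas z) (Eventually.of_forall fun ω => ?_)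
    rw [norm_mul]
    gcongr
    exact hexp z _ le_rfl ω
  · refine Eventually.of_forall fun ω w hw => ?_
    have hw' : ‖w‖ ≤ ‖z‖ + 1 := by
      have h1 : ‖w - z‖ < 1 := by simpa [dist_eq_norm] using hw
      have h2 : ‖w‖ ≤ ‖z‖ + ‖w - z‖ := by simpa using norm_add_le z (w - z)
      linarith
    rw [norm_mul, norm_mul, Complex.norm_real, Real.norm_eq_abs]
    gcongr
    calc |Y ω| * ‖Complex.exp (w * Y ω)‖ ≤ Real.exp |Y ω| * Real.exp ((‖z‖ + 1) * |Y ω|) := by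
          gcongr
          · linarith [Real.add_one_le_exp |Y ω|]
          · exact hexp w _ hw' ω
      _ = _ := by rw [← Real.exp_add]; congr 1; ring
  · refine Eventually.of_forall fun ω w _ => ?_
    have : HasDerivAt (fun w : ℂ => w * (Y ω : ℂ)) (Y ω : ℂ) w := by
      simpa using (hasDerivAt_id w).mul_const (Y ω : ℂ)
    refine (this.cexp.const_mul (W ω)).congr_deriv ?_
    ring

end ExponentialMoments

/-! ### The identity theorem -/

/-- Two entire functions that agree on the real line are equal. -/
theorem eq_of_differentiable_of_eqOn_real {f g : ℂ → ℂ} (hf : Differentiable ℂ f)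
    (hg : Differentiable ℂ g) (h : ∀ t : ℝ, f t = g t) : f = g := by
  refine AnalyticOnNhd.eq_of_frequently_eq (z₀ := 0) (fun z _ => hf.analyticAt z)
    (fun z _ => hg.analyticAt z) ?_
  have hreal : Tendsto (fun t : ℝ => (t : ℂ)) (𝓝[≠] 0) (𝓝[≠] 0) := by
    refine tendsto_nhdsWithin_iff.2 ⟨?_, ?_⟩
    · exact (Complex.continuous_ofReal.tendsto' 0 0 (by simp)).mono_left nhdsWithin_le_nhds
    · filter_upwards [self_mem_nhdsWithin] with t ht
      simpa using ht
  exact hreal.frequently (Eventually.of_forall h).frequently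

/-! ### Bilinear pairings as `L²` inner products -/

/-- The inclusion of `𝒮(ℝ)` into `L²(ℝ)`. -/
abbrev schwartzInclL2 : 𝓢(ℝ, ℝ) →L[ℝ] Lp ℝ 2 (volume : Measure ℝ) :=
  SchwartzMap.toLpCLM ℝ ℝ 2 volume

theorem integrable_schwartz_mul_L2 (u : 𝓢(ℝ, ℝ)) (g : Lp ℝ 2 (volume : Measure ℝ)) :
    Integrable fun x => u x * g x :=
  (u.memLp 2 volume).integrable_mul (Lp.memLp g)

theorem inner_schwartzInclL2_left (u : 𝓢(ℝ, ℝ)) (g : Lp ℝ 2 (volume : Measure ℝ)) :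
    inner ℝ (schwartzInclL2 u) g = ∫ x, u x * g x := by
  rw [L2.inner_def]
  refine integral_congr_ae ?_
  filter_upwards [u.coeFn_toLp 2 volume] with x hx
  rw [SchwartzMap.toLpCLM_apply, hx]
  simp [mul_comm]

theorem inner_schwartzInclL2 (u v : 𝓢(ℝ, ℝ)) :
    inner ℝ (schwartzInclL2 u) (schwartzInclL2 v) = ∫ x, u x * v x := by
  rw [inner_schwartzInclL2_left]
  refine integral_congr_ae ?_
  filter_upwards [v.coeFn_toLp 2 volume] with x hx
  rw [SchwartzMap.toLpCLM_apply, hx]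

theorem integrable_schwartz_mul (u v : 𝓢(ℝ, ℝ)) : Integrable fun x => u x * v x :=
  (u.memLp 2 volume).integrable_mul (v.memLp 2 volume)

theorem schwartzRe_add_I_mul_schwartzIm (f : 𝓢(ℝ, ℂ)) (x : ℝ) :
    f x = (schwartzRe f x : ℂ) + Complex.I * (schwartzIm f x : ℂ) := by
  simp only [schwartzRe, schwartzIm, SchwartzMap.postcompCLM_apply, Complex.reCLM_apply,
    Complex.imCLM_apply]
  rw [mul_comm, Complex.re_add_im]

theorem schwartzL2Pairing_eq_inner (f : 𝓢(ℝ, ℂ)) (g : Lp ℝ 2 (volume : Measure ℝ)) :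
    schwartzL2Pairing f g = (inner ℝ (schwartzInclL2 (schwartzRe f)) g : ℝ)
      + Complex.I * (inner ℝ (schwartzInclL2 (schwartzIm f)) g : ℝ) := by
  have h : ∀ x, f x * (g x : ℂ) = ((schwartzRe f x * g x : ℝ) : ℂ)
      + Complex.I * ((schwartzIm f x * g x : ℝ) : ℂ) := fun x => by
    rw [schwartzRe_add_I_mul_schwartzIm f x]
    push_cast
    ring
  rw [inner_schwartzInclL2_left, inner_schwartzInclL2_left, schwartzL2Pairing]
  simp only [h]
  rw [integral_add (integrable_schwartz_mul_L2 _ _).ofReal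
    ((integrable_schwartz_mul_L2 _ _).ofReal.const_mul _), integral_const_mul,
    integral_complex_ofReal, integral_complex_ofReal]

theorem schwartzSelfPairing_eq_inner (f : 𝓢(ℝ, ℂ)) :
    schwartzSelfPairing f =
      (inner ℝ (schwartzInclL2 (schwartzRe f)) (schwartzInclL2 (schwartzRe f)) : ℝ)
      - (inner ℝ (schwartzInclL2 (schwartzIm f)) (schwartzInclL2 (schwartzIm f)) : ℝ)
      + 2 * Complex.I *
        (inner ℝ (schwartzInclL2 (schwartzRe f)) (schwartzInclL2 (schwartzIm f)) : ℝ) := by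
  have h : ∀ x, f x * f x = ((schwartzRe f x * schwartzRe f x : ℝ) : ℂ)
      - ((schwartzIm f x * schwartzIm f x : ℝ) : ℂ)
      + 2 * Complex.I * ((schwartzRe f x * schwartzIm f x : ℝ) : ℂ) := fun x => by
    rw [schwartzRe_add_I_mul_schwartzIm f x]
    push_cast
    linear_combination (schwartzIm f x : ℂ) ^ 2 * Complex.I_sq
  have hi := fun u v => (integrable_schwartz_mul u v).ofReal (𝕜 := ℂ)
  simp only [inner_schwartzInclL2, schwartzSelfPairing, h]
  have hadd := integral_add ((hi (schwartzRe f) (schwartzRe f)).sub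
    (hi (schwartzIm f) (schwartzIm f)))
    ((hi (schwartzRe f) (schwartzIm f)).const_mul (2 * Complex.I))
  have hsub := integral_sub (hi (schwartzRe f) (schwartzRe f)) (hi (schwartzIm f) (schwartzIm f))
  simp only [Pi.sub_apply, Complex.coe_algebraMap] at hadd hsub
  rw [hadd, hsub, integral_const_mul]
  simp only [integral_complex_ofReal]

/-! ### The Laplace transform of the Mittag-Leffler measure -/

@[fun_prop]
theorem measurable_tempered_apply (ψ : 𝓢(ℝ, ℝ)) : Measurable fun ω : RealTempered => ω ψ := by
  rw [BorelSpace.measurable_eq (α := ℝ)]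
  exact (comap_measurable (m := borel ℝ) fun ω : RealTempered => ω ψ).mono
    (le_iSup (fun φ : 𝓢(ℝ, ℝ) =>
      MeasurableSpace.comap (fun ω : RealTempered => ω φ) (borel ℝ)) ψ) le_rfl

section LaplaceTransform

variable {β : ℝ} {μ : Measure RealTempered}

/-- The characteristic function of `μ_β` along the line through `ψ`. -/
theorem integral_cexp_I_mul (hμ : IsMittagLefflerMeasure β μ) (ψ : 𝓢(ℝ, ℝ)) (t : ℝ) :
    ∫ ω, Complex.exp (t * Complex.I * (ω ψ : ℝ)) ∂μ
      = mittagLeffler β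
          (-(1 / 2) * (t ^ 2 * (inner ℝ (schwartzInclL2 ψ) (schwartzInclL2 ψ) : ℝ))) := by
  have h := hμ.charFun_eq (t • ψ)
  rw [← inner_schwartzInclL2, map_smul, real_inner_smul_left, real_inner_smul_right] at h
  convert h using 3 with ω
  · simp only [map_smul, smul_eq_mul]
    push_cast
    ring_nf
  · push_cast
    ring

theorem integral_cos_mul (hμ : IsMittagLefflerMeasure β μ) (ψ : 𝓢(ℝ, ℝ)) (t : ℝ) :
    ∫ ω, Real.cos (t * ω ψ) ∂μ
      = (mittagLeffler β
          (-(1 / 2) * ((t : ℂ) ^ 2 * (inner ℝ (schwartzInclL2 ψ) (schwartzInclL2 ψ) : ℝ)))).re := by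
  have := hμ.isProbabilityMeasure
  have hi : Integrable (fun ω : RealTempered => Complex.exp (t * Complex.I * (ω ψ : ℝ))) μ := by
    refine (integrable_const (1 : ℝ)).mono' (Measurable.aestronglyMeasurable (by fun_prop))
      (Eventually.of_forall fun ω => ?_)
    rw [Complex.norm_exp]
    simp
  rw [← integral_cexp_I_mul hμ, ← RCLike.re_eq_complex_re, ← integral_re hi]
  refine integral_congr_ae (Eventually.of_forall fun ω => ?_)
  simp [Complex.exp_re]

theorem differentiable_mittagLeffler_quadratic (hβ : 0 < β) (c₀ c₁ c₂ : ℂ) :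
    Differentiable ℂ fun z => mittagLeffler β (c₀ + z * c₁ + z ^ 2 * c₂) :=
  (differentiable_mittagLeffler hβ).comp (by fun_prop)

theorem integrable_exp_mul_abs (hβ : 0 < β) (hμ : IsMittagLefflerMeasure β μ) (ψ : 𝓢(ℝ, ℝ))
    (a : ℝ) : Integrable (fun ω : RealTempered => Real.exp (a * |ω ψ|)) μ := by
  have := hμ.isProbabilityMeasure
  exact integrable_exp_mul_abs_of_entire (measurable_tempered_apply ψ)
    (F := fun z => mittagLeffler β
      (-(1 / 2) * (z ^ 2 * (inner ℝ (schwartzInclL2 ψ) (schwartzInclL2 ψ) : ℝ))))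
    ((differentiable_mittagLeffler hβ).comp (by fun_prop)) (integral_cos_mul hμ ψ) a

theorem integrable_exp_mul_abs_mul_exp_mul_abs (hβ : 0 < β) (hμ : IsMittagLefflerMeasure β μ)
    (ψ₁ ψ₂ : 𝓢(ℝ, ℝ)) (a b : ℝ) :
    Integrable (fun ω : RealTempered => Real.exp (a * |ω ψ₁|) * Real.exp (b * |ω ψ₂|)) μ := by
  refine ((integrable_exp_mul_abs hβ hμ ψ₁ (2 * a)).add
    (integrable_exp_mul_abs hβ hμ ψ₂ (2 * b))).mono' (by fun_prop)
    (Eventually.of_forall fun ω => ?_)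
  rw [Real.norm_of_nonneg (by positivity)]
  simp only [Pi.add_apply, two_mul, add_mul, Real.exp_add]
  nlinarith [sq_nonneg (Real.exp (a * |ω ψ₁|) - Real.exp (b * |ω ψ₂|)),
    sq_nonneg (Real.exp (a * |ω ψ₁|)), sq_nonneg (Real.exp (b * |ω ψ₂|))]

/-- The second moments of `μ_β` are a constant multiple of the squared `L²(ℝ)` norm, because the
characteristic function along `ψ` is a fixed function rescaled by that norm. -/
theorem exists_integral_sq_eq (hβ : 0 < β) (hμ : IsMittagLefflerMeasure β μ) :
    ∃ C : ℝ, ∀ ψ : 𝓢(ℝ, ℝ), Integrable (fun ω : RealTempered => ω ψ ^ 2) μ ∧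
      ∫ ω, ω ψ ^ 2 ∂μ = C * ‖schwartzInclL2 ψ‖ ^ 2 := by
  have := hμ.isProbabilityMeasure
  set F : ℂ → ℂ := fun z => mittagLeffler β (-(1 / 2) * z ^ 2) with hF
  have hFd : Differentiable ℂ F := (differentiable_mittagLeffler hβ).comp (by fun_prop)
  refine ⟨-(iteratedDeriv 2 F 0).re, fun ψ => ?_⟩
  have h := integral_pow_mul_cos_of_entire (measurable_tempered_apply ψ)
    (F := fun z => F ((‖schwartzInclL2 ψ‖ : ℝ) * z)) (hFd.comp (by fun_prop))
    (fun t => by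
      rw [integral_cos_mul hμ ψ t, real_inner_self_eq_norm_sq]
      simp only [hF]
      congr 2
      push_cast
      ring) 1
  refine ⟨by simpa using h.1, ?_⟩
  have h2 := h.2 0
  rw [iteratedDeriv_comp_const_mul (hFd.contDiff (n := 2))] at h2
  simp only [zero_mul, Real.cos_zero, mul_one, pow_one, Complex.ofReal_zero, mul_zero,
    ← Complex.ofReal_pow, Complex.re_ofReal_mul] at h2
  rw [h2]
  ring

/-- The complex linear extension of `ω ∈ 𝒮'(ℝ)` to complex-valued Schwartz functions. -/
def temperedApplyC (f : 𝓢(ℝ, ℂ)) (ω : RealTempered) : ℂ :=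
  (ω (schwartzRe f) : ℂ) + Complex.I * (ω (schwartzIm f) : ℂ)

@[fun_prop]
theorem measurable_temperedApplyC (f : 𝓢(ℝ, ℂ)) : Measurable (temperedApplyC f) := by
  unfold temperedApplyC
  fun_prop

theorem norm_cexp_temperedApplyC (f : 𝓢(ℝ, ℂ)) (ω : RealTempered) :
    ‖Complex.exp (temperedApplyC f ω)‖ = Real.exp (ω (schwartzRe f)) := by
  rw [Complex.norm_exp]
  simp [temperedApplyC]

/-- The Laplace transform of `μ_β` on real test functions: both sides are entire along each line,
and they agree on the imaginary axis. -/
theorem integral_cexp_real (hβ : 0 < β) (hμ : IsMittagLefflerMeasure β μ) (ψ : 𝓢(ℝ, ℝ)) :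
    ∫ ω, Complex.exp (ω ψ : ℝ) ∂μ
      = mittagLeffler β ((1 / 2) * (inner ℝ (schwartzInclL2 ψ) (schwartzInclL2 ψ) : ℝ)) := by
  have hint : ∀ a : ℝ, Integrable
      (fun ω : RealTempered => ‖(1 : ℂ)‖ * Real.exp (a * |ω ψ|)) μ := fun a => by
    simpa using integrable_exp_mul_abs hβ hμ ψ a
  have hent : Differentiable ℂ fun z : ℂ => ∫ ω, (1 : ℂ) * Complex.exp (z * (ω ψ : ℝ)) ∂μ :=
    fun z => (hasDerivAt_integral_mul_cexp aestronglyMeasurable_const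
      (measurable_tempered_apply ψ) hint z).differentiableAt
  have heq := eq_of_differentiable_of_eqOn_real
    (f := fun z => ∫ ω, (1 : ℂ) * Complex.exp (z * Complex.I * (ω ψ : ℝ)) ∂μ)
    (hent.comp (by fun_prop : Differentiable ℂ fun z : ℂ => z * Complex.I))
    (differentiable_mittagLeffler_quadratic hβ 0 0
      (-(1 / 2) * (inner ℝ (schwartzInclL2 ψ) (schwartzInclL2 ψ) : ℝ)))
    (fun t => by
      simp only [one_mul]
      rw [integral_cexp_I_mul hμ ψ t]
      congr 1
      ring)
  have h := congrFun heq (-Complex.I)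
  simp only [one_mul, neg_mul, Complex.I_mul_I, neg_neg] at h
  rw [h]
  congr 1
  rw [neg_sq, Complex.I_sq]
  ring

/-- The Laplace transform of `μ_β` at `u + i v`, by analytic continuation in the
coefficient of the imaginary part. -/
theorem integral_cexp_add_I_mul (hβ : 0 < β) (hμ : IsMittagLefflerMeasure β μ)
    (u v : 𝓢(ℝ, ℝ)) :
    ∫ ω, Complex.exp ((ω u : ℝ) + Complex.I * (ω v : ℝ)) ∂μ
      = mittagLeffler β ((1 / 2) * ((inner ℝ (schwartzInclL2 u) (schwartzInclL2 u) : ℝ)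
        - (inner ℝ (schwartzInclL2 v) (schwartzInclL2 v) : ℝ)
        + 2 * Complex.I * (inner ℝ (schwartzInclL2 u) (schwartzInclL2 v) : ℝ))) := by
  have hint : ∀ a : ℝ, Integrable (fun ω : RealTempered =>
      ‖Complex.exp (ω u : ℝ)‖ * Real.exp (a * |ω v|)) μ := fun a => by
    refine (integrable_exp_mul_abs_mul_exp_mul_abs hβ hμ u v 1 a).mono' (by fun_prop)
      (Eventually.of_forall fun ω => ?_)
    rw [Real.norm_of_nonneg (by positivity), Complex.norm_exp, Complex.ofReal_re, one_mul]
    gcongr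
    exact le_abs_self _
  have hent : Differentiable ℂ fun z : ℂ =>
      ∫ ω, Complex.exp (ω u : ℝ) * Complex.exp (z * (ω v : ℝ)) ∂μ := fun z =>
    (hasDerivAt_integral_mul_cexp (Measurable.aestronglyMeasurable (by fun_prop))
      (measurable_tempered_apply v) hint z).differentiableAt
  have heq := eq_of_differentiable_of_eqOn_real hent
    (differentiable_mittagLeffler_quadratic hβ
      (1 / 2 * (inner ℝ (schwartzInclL2 u) (schwartzInclL2 u) : ℝ))
      (inner ℝ (schwartzInclL2 u) (schwartzInclL2 v) : ℝ)
      (1 / 2 * (inner ℝ (schwartzInclL2 v) (schwartzInclL2 v) : ℝ)))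
    (fun t => by
      have h := integral_cexp_real hβ hμ (u + t • v)
      simp only [map_add, map_smul, smul_eq_mul, inner_add_left, inner_add_right,
        real_inner_smul_left, real_inner_smul_right,
        real_inner_comm (schwartzInclL2 u) (schwartzInclL2 v)] at h
      simp only [← Complex.exp_add]
      convert h using 2
      · push_cast; rfl
      · push_cast; ring)
  have h := congrFun heq Complex.I
  simp only [← Complex.exp_add] at h
  rw [h]
  congr 1
  rw [Complex.I_sq]
  ring

/-- The Laplace transform of `μ_β`: `∫ exp ⟨ω, f⟩ dμ_β(ω) = E_β(½ ⟨f, f⟩)` for complex `f`. -/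
theorem integral_cexp_temperedApplyC (hβ : 0 < β) (hμ : IsMittagLefflerMeasure β μ)
    (f : 𝓢(ℝ, ℂ)) :
    ∫ ω, Complex.exp (temperedApplyC f ω) ∂μ = mittagLeffler β (schwartzSelfPairing f / 2) := by
  simp only [temperedApplyC]
  rw [integral_cexp_add_I_mul hβ hμ, schwartzSelfPairing_eq_inner]
  congr 1
  ring

theorem integrable_norm_cexp_temperedApplyC_mul (hβ : 0 < β) (hμ : IsMittagLefflerMeasure β μ)
    (f : 𝓢(ℝ, ℂ)) (ψ : 𝓢(ℝ, ℝ)) (a : ℝ) :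
    Integrable (fun ω => ‖Complex.exp (temperedApplyC f ω)‖ * Real.exp (a * |ω ψ|)) μ := by
  refine (integrable_exp_mul_abs_mul_exp_mul_abs hβ hμ (schwartzRe f) ψ 1 a).mono' (by fun_prop)
      (Eventually.of_forall fun ω => ?_)
  rw [Real.norm_of_nonneg (by positivity), norm_cexp_temperedApplyC, one_mul]
  gcongr
  exact le_abs_self _

theorem integrable_norm_sq_cexp_temperedApplyC (hβ : 0 < β) (hμ : IsMittagLefflerMeasure β μ)
    (f : 𝓢(ℝ, ℂ)) : Integrable (fun ω => ‖Complex.exp (temperedApplyC f ω)‖ ^ 2) μ := by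
  simp only [norm_cexp_temperedApplyC]
  refine (integrable_exp_mul_abs hβ hμ (schwartzRe f) 2).mono'
    (Measurable.aestronglyMeasurable (by fun_prop))
    (Eventually.of_forall fun ω => ?_)
  rw [Real.norm_of_nonneg (by positivity), ← Real.exp_nat_mul]
  push_cast
  gcongr
  exact le_abs_self _

/-- The derivative of the Laplace transform at `f` in the direction of `ψ`, by the chain rule
from `E_β' = E_{β,β} / β`. -/
theorem integral_apply_mul_cexp_temperedApplyC (hβ : 0 < β) (hμ : IsMittagLefflerMeasure β μ)
    (f : 𝓢(ℝ, ℂ)) (ψ : 𝓢(ℝ, ℝ)) :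
    ∫ ω, (ω ψ : ℂ) * Complex.exp (temperedApplyC f ω) ∂μ
      = mittagLeffler₂ β β (schwartzSelfPairing f / 2) / β
        * schwartzL2Pairing f (schwartzInclL2 ψ) := by
  have hder := fun z => hasDerivAt_integral_mul_cexp (by fun_prop) (measurable_tempered_apply ψ)
    (integrable_norm_cexp_temperedApplyC_mul hβ hμ f ψ) z
  have heq := eq_of_differentiable_of_eqOn_real (fun z => (hder z).differentiableAt)
    (differentiable_mittagLeffler_quadratic hβ (schwartzSelfPairing f / 2)
      (schwartzL2Pairing f (schwartzInclL2 ψ))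
      (1 / 2 * (inner ℝ (schwartzInclL2 ψ) (schwartzInclL2 ψ) : ℝ)))
    (fun t => by
      have h := integral_cexp_add_I_mul hβ hμ (schwartzRe f + t • ψ) (schwartzIm f)
      simp only [map_add, map_smul, smul_eq_mul, inner_add_left, inner_add_right,
        real_inner_smul_left, real_inner_smul_right] at h
      simp only [← Complex.exp_add, temperedApplyC, schwartzSelfPairing_eq_inner,
        schwartzL2Pairing_eq_inner]
      rw [real_inner_comm (schwartzInclL2 (schwartzRe f)) (schwartzInclL2 ψ),
        real_inner_comm (schwartzInclL2 (schwartzIm f)) (schwartzInclL2 ψ)] at *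
      convert h using 2
      · ext ω; push_cast; ring_nf
      · push_cast; ring)
  have h1 := hder 0
  rw [heq] at h1
  have hq : HasDerivAt (fun z : ℂ => schwartzSelfPairing f / 2
      + z * schwartzL2Pairing f (schwartzInclL2 ψ)
      + z ^ 2 * (1 / 2 * (inner ℝ (schwartzInclL2 ψ) (schwartzInclL2 ψ) : ℝ)))
      (schwartzL2Pairing f (schwartzInclL2 ψ)) 0 := by
    have h2 := (((hasDerivAt_id (0 : ℂ)).mul_const
      (schwartzL2Pairing f (schwartzInclL2 ψ))).const_add (schwartzSelfPairing f / 2)).add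
      ((hasDerivAt_pow 2 (0 : ℂ)).mul_const
        (1 / 2 * ((inner ℝ (schwartzInclL2 ψ) (schwartzInclL2 ψ) : ℝ) : ℂ)))
    refine h2.congr_deriv ?_
    simp
  have h3 := HasDerivAt.comp (h₂ := mittagLeffler β) 0 (hasDerivAt_mittagLeffler hβ _) hq
  have h4 := h1.unique h3
  simp only [zero_mul, Complex.exp_zero, mul_one, add_zero, ne_eq, OfNat.ofNat_ne_zero,
    not_false_eq_true, zero_pow] at h4
  rw [← h4]
  simp only [mul_comm]

end LaplaceTransform

/-! ### The product measure -/

section ProductMeasure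

variable {β : ℝ} {μ : Measure RealTempered} {d : ℕ}

theorem pairingC_eq_sum (φ : SchwartzVecC d) (ω : RealTemperedVec d) :
    pairingC φ ω = ∑ k, temperedApplyC (φ k) (ω k) := by
  simp only [pairingC, pairing, temperedApplyC, Finset.sum_add_distrib, Complex.ofReal_sum,
    Finset.mul_sum]

theorem cexp_pairingC (φ : SchwartzVecC d) (ω : RealTemperedVec d) :
    Complex.exp (pairingC φ ω) = ∏ k, Complex.exp (temperedApplyC (φ k) (ω k)) := by
  rw [pairingC_eq_sum, Complex.exp_sum]

/-- By Fubini's theorem the Laplace transform of the product measure factorizes. -/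
theorem laplace_eq_prod (hβ : 0 < β) (hμ : IsMittagLefflerMeasure β μ) (φ : SchwartzVecC d) :
    laplace μ φ = ∏ k, mittagLeffler β (schwartzSelfPairing (φ k) / 2) := by
  have := hμ.isProbabilityMeasure
  simp only [laplace, prodMeasure, cexp_pairingC]
  rw [integral_fintype_prod_eq_prod (fun k ω => Complex.exp (temperedApplyC (φ k) ω))]
  simp only [integral_cexp_temperedApplyC hβ hμ]

theorem measurable_cexp_pairingC (φ : SchwartzVecC d) :
    Measurable fun ω => Complex.exp (pairingC φ ω) := by
  simp only [pairingC_eq_sum]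
  refine Complex.measurable_exp.comp (Finset.measurable_sum _ fun k _ => ?_)
  exact (measurable_temperedApplyC (φ k)).comp (measurable_pi_apply k)

theorem memLp_normalizedExp (hβ : 0 < β) (hμ : IsMittagLefflerMeasure β μ) (φ : SchwartzVecC d) :
    MemLp (normalizedExp μ φ) 2 (prodMeasure d μ) := by
  have := hμ.isProbabilityMeasure
  have hexp : MemLp (fun ω => Complex.exp (pairingC φ ω)) 2 (prodMeasure d μ) := by
    rw [memLp_two_iff_integrable_sq_norm (measurable_cexp_pairingC φ).aestronglyMeasurable]
    simp only [cexp_pairingC, norm_prod, ← Finset.prod_pow]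
    exact Integrable.fintype_prod (f := fun k ω => ‖Complex.exp (temperedApplyC (φ k) ω)‖ ^ 2)
      fun k => integrable_norm_sq_cexp_temperedApplyC hβ hμ (φ k)
  have := hexp.const_mul (laplace μ φ)⁻¹
  refine this.ae_eq (Eventually.of_forall fun ω => ?_)
  simp only [normalizedExp]
  rw [div_eq_inv_mul]

theorem memLp_eval_apply (hβ : 0 < β) (hμ : IsMittagLefflerMeasure β μ) (k : Fin d)
    (ψ : 𝓢(ℝ, ℝ)) : MemLp (fun ω : RealTemperedVec d => ω k ψ) 2 (prodMeasure d μ) := by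
  have := hμ.isProbabilityMeasure
  obtain ⟨C, hC⟩ := exists_integral_sq_eq hβ hμ
  have h : MemLp (fun ω : RealTempered => ω ψ) 2 μ :=
    (memLp_two_iff_integrable_sq (measurable_tempered_apply ψ).aestronglyMeasurable).2 (hC ψ).1
  exact h.comp_measurePreserving (measurePreserving_eval (fun _ : Fin d => μ) k)

theorem memLp_pairing (hβ : 0 < β) (hμ : IsMittagLefflerMeasure β μ) (φ : SchwartzVec d) :
    MemLp (pairing φ) 2 (prodMeasure d μ) :=
  memLp_finsetSum _ fun k _ => memLp_eval_apply hβ hμ k (φ k)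

/-! ### Extension of the dual pairing to `L²_d(ℝ)` -/

/-- The linear map `φ ↦ ⟨·, φ⟩` from `𝒮_d(ℝ)` to `L²(μ_β^{⊗d})`. -/
def pairingLinearMap (hβ : 0 < β) (hμ : IsMittagLefflerMeasure β μ) (d : ℕ) :
    SchwartzVec d →ₗ[ℝ] Lp ℝ 2 (prodMeasure d μ) where
  toFun φ := (memLp_pairing hβ hμ φ).toLp
  map_add' φ ψ := by
    rw [← MemLp.toLp_add]
    refine MemLp.toLp_congr _ _ (Eventually.of_forall fun ω => ?_)
    simp [pairing, Finset.sum_add_distrib]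
  map_smul' c φ := by
    rw [RingHom.id_apply, ← MemLp.toLp_const_smul]
    refine MemLp.toLp_congr _ _ (Eventually.of_forall fun ω => ?_)
    simp [pairing, Finset.mul_sum]

/-- The linear map underlying `schwartzToL2`. -/
def schwartzToL2LinearMap (d : ℕ) : SchwartzVec d →ₗ[ℝ] L2Vec d where
  toFun := schwartzToL2
  map_add' φ ψ := by
    ext1 k
    exact map_add schwartzInclL2 (φ k) (ψ k)
  map_smul' c φ := by
    ext1 k
    exact map_smul schwartzInclL2 c (φ k)

theorem denseRange_schwartzToL2 (d : ℕ) : DenseRange (schwartzToL2 (d := d)) := by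
  have h : DenseRange (Pi.map fun (_ : Fin d) (f : 𝓢(ℝ, ℝ)) => schwartzInclL2 f) :=
    DenseRange.piMap fun _ => SchwartzMap.denseRange_toLpCLM (by simp)
  exact (WithLp.toLp_surjective 2).denseRange.comp h (PiLp.continuous_toLp 2 _)

/-- The bound of `⟨·, φ⟩` in `L²(μ_β^{⊗d})`, summed over the coordinates with the second moments
of `μ_β`. -/
theorem exists_norm_pairingLinearMap_le (hβ : 0 < β) (hμ : IsMittagLefflerMeasure β μ) (d : ℕ) :
    ∃ C, ∀ φ : SchwartzVec d,
      ‖pairingLinearMap hβ hμ d φ‖ ≤ C * ‖schwartzToL2LinearMap d φ‖ := by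
  have := hμ.isProbabilityMeasure
  obtain ⟨C, hC⟩ := exists_integral_sq_eq hβ hμ
  refine ⟨∑ _k : Fin d, Real.sqrt |C|, fun φ => ?_⟩
  have hk : ∀ k, ‖(memLp_eval_apply hβ hμ k (φ k)).toLp‖
      ≤ Real.sqrt |C| * ‖schwartzToL2LinearMap d φ‖ := fun k => by
    have h1 : ‖(memLp_eval_apply hβ hμ k (φ k)).toLp‖ ^ 2 = C * ‖schwartzInclL2 (φ k)‖ ^ 2 := by
      have h2 := measurePreserving_eval (fun _ : Fin d => μ) k
      have hmap := integral_map h2.aemeasurable (f := fun ω : RealTempered => ω (φ k) ^ 2)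
        ((measurable_tempered_apply (φ k)).pow_const 2).aestronglyMeasurable
      rw [h2.map_eq] at hmap
      rw [← (hC (φ k)).2, hmap, ← real_inner_self_eq_norm_sq, L2.inner_def]
      refine integral_congr_ae ?_
      filter_upwards [(memLp_eval_apply hβ hμ k (φ k)).coeFn_toLp] with ω hω
      rw [hω]
      simp [pow_two]
    have h3 : ‖schwartzInclL2 (φ k)‖ ≤ ‖schwartzToL2LinearMap d φ‖ :=
      PiLp.norm_apply_le (schwartzToL2 φ) k
    refine le_of_sq_le_sq ?_ (by positivity)
    rw [h1, mul_pow, Real.sq_sqrt (abs_nonneg C)]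
    gcongr
    exact le_abs_self C
  have hsum : pairingLinearMap hβ hμ d φ = ∑ k, (memLp_eval_apply hβ hμ k (φ k)).toLp := by
    refine Lp.ext ?_
    refine (memLp_pairing hβ hμ φ).coeFn_toLp.trans ?_
    refine EventuallyEq.trans ?_ (Lp.coeFn_finsetSum _ _).symm
    have hall : ∀ᵐ ω ∂(prodMeasure d μ), ∀ k,
        ((memLp_eval_apply hβ hμ k (φ k)).toLp : RealTemperedVec d → ℝ) ω = ω k (φ k) :=
      ae_all_iff.2 fun k => (memLp_eval_apply hβ hμ k (φ k)).coeFn_toLp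
    filter_upwards [hall] with ω hω
    simp [pairing, hω]
  rw [hsum, Finset.sum_mul]
  exact (norm_sum_le _ _).trans (Finset.sum_le_sum fun k _ => hk k)

/-- `φ ↦ ⟨·, φ⟩` is bounded for the `L²` norms, so it extends continuously to `L²_d(ℝ)`. -/
theorem exists_isL2Pairing (hβ : 0 < β) (hμ : IsMittagLefflerMeasure β μ) (η : L2Vec d) :
    ∃ X, IsL2Pairing μ η X := by
  set T := (pairingLinearMap hβ hμ d).extendOfNorm (schwartzToL2LinearMap d)
  have hT : ∀ φ, T (schwartzToL2 φ) = pairingLinearMap hβ hμ d φ :=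
    LinearMap.extendOfNorm_eq (denseRange_schwartzToL2 d)
      (exists_norm_pairingLinearMap_le hβ hμ d)
  refine ⟨T η, Lp.memLp _, fun φ hφ => ?_⟩
  have h := (T.continuous.tendsto η).comp hφ
  rw [Lp.tendsto_Lp_iff_tendsto_eLpNorm'] at h
  refine h.congr fun n => eLpNorm_congr_ae ?_
  simp only [Function.comp_apply, hT]
  filter_upwards [(memLp_pairing hβ hμ (φ n)).coeFn_toLp] with ω hω
  simp only [Pi.sub_apply]
  congr 1

theorem isL2Pairing_l2Pairing (hβ : 0 < β) (hμ : IsMittagLefflerMeasure β μ) (η : L2Vec d) :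
    IsL2Pairing μ η (l2Pairing μ η) := by
  have h := exists_isL2Pairing hβ hμ η
  rw [l2Pairing, dif_pos h]
  exact h.choose_spec

/-! ### The `S`-transform -/

/-- Fubini's theorem for `⟨ω_k, ψ⟩ exp ⟨ω, φ⟩`: only the `k`-th factor of the Laplace transform is
replaced by its derivative in the direction of `ψ`. -/
theorem integral_eval_apply_mul_cexp_pairingC (hβ : 0 < β) (hμ : IsMittagLefflerMeasure β μ)
    (φ : SchwartzVecC d) (hφ : ∀ k, mittagLeffler β (schwartzSelfPairing (φ k) / 2) ≠ 0)
    (k : Fin d) (ψ : 𝓢(ℝ, ℝ)) :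
    ∫ ω, (ω k ψ : ℂ) * Complex.exp (pairingC φ ω) ∂(prodMeasure d μ)
      = laplace μ φ * (sCoefficient β (φ k) * schwartzL2Pairing (φ k) (schwartzInclL2 ψ)) := by
  have := hμ.isProbabilityMeasure
  have hprod : ∀ ω : RealTemperedVec d, (ω k ψ : ℂ) * Complex.exp (pairingC φ ω)
      = ∏ j, Function.update (fun j ω => Complex.exp (temperedApplyC (φ j) ω)) k
        (fun ω : RealTempered => (ω ψ : ℂ) * Complex.exp (temperedApplyC (φ k) ω)) j (ω j) := by
    intro ω
    rw [cexp_pairingC, ← Finset.mul_prod_erase _ _ (Finset.mem_univ k),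
      ← Finset.mul_prod_erase _ _ (Finset.mem_univ k), Function.update_self, mul_assoc]
    congr 2
    refine Finset.prod_congr rfl fun j hj => ?_
    rw [Function.update_of_ne (Finset.ne_of_mem_erase hj)]
  simp only [hprod, prodMeasure]
  rw [integral_fintype_prod_eq_prod, laplace_eq_prod hβ hμ,
    ← Finset.mul_prod_erase _ _ (Finset.mem_univ k),
    ← Finset.mul_prod_erase _ _ (Finset.mem_univ k), Function.update_self,
    integral_apply_mul_cexp_temperedApplyC hβ hμ, sCoefficient]
  have herase : ∏ j ∈ Finset.univ.erase k, ∫ ω,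
      Function.update (fun j ω => Complex.exp (temperedApplyC (φ j) ω)) k
        (fun ω : RealTempered => (ω ψ : ℂ) * Complex.exp (temperedApplyC (φ k) ω)) j ω ∂μ
      = ∏ j ∈ Finset.univ.erase k, mittagLeffler β (schwartzSelfPairing (φ j) / 2) := by
    refine Finset.prod_congr rfl fun j hj => ?_
    rw [Function.update_of_ne (Finset.ne_of_mem_erase hj), integral_cexp_temperedApplyC hβ hμ]
  rw [herase]
  have h1 := hφ k
  have h2 : (β : ℂ) ≠ 0 := by exact_mod_cast hβ.ne'
  field_simp

/-- The `S`-transform of `⟨·, ψ⟩` for a test function `ψ`: the term `⟨ω_k, ψ_k⟩` only meets the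
`k`-th factor of the normalized exponential, and the other factors integrate to one. -/
theorem sTransform_pairing (hβ : 0 < β) (hμ : IsMittagLefflerMeasure β μ)
    (φ : SchwartzVecC d) (hφ : ∀ k, mittagLeffler β (schwartzSelfPairing (φ k) / 2) ≠ 0)
    (ψ : SchwartzVec d) :
    sTransform μ (fun ω => ((pairing ψ ω : ℝ) : ℂ)) φ
      = ∑ k, sCoefficient β (φ k) * schwartzL2Pairing (φ k) (schwartzInclL2 (ψ k)) := by
  have hl : laplace μ φ ≠ 0 := by
    rw [laplace_eq_prod hβ hμ]
    exact Finset.prod_ne_zero_iff.2 fun k _ => hφ k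
  have hterm : ∀ ω, ((pairing ψ ω : ℝ) : ℂ) * normalizedExp μ φ ω
      = ∑ k, (ω k (ψ k) : ℂ) * normalizedExp μ φ ω := fun ω => by
    rw [pairing, Complex.ofReal_sum, Finset.sum_mul]
  have hint : ∀ k, Integrable (fun ω => (ω k (ψ k) : ℂ) * normalizedExp μ φ ω)
      (prodMeasure d μ) := fun k =>
    (memLp_eval_apply hβ hμ k (ψ k)).ofReal.integrable_mul (memLp_normalizedExp hβ hμ φ)
  simp only [sTransform, dualPairing, hterm]
  rw [integral_finsetSum _ fun k _ => hint k]
  refine Finset.sum_congr rfl fun k _ => ?_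
  simp only [normalizedExp, ← mul_div_assoc]
  rw [integral_div, integral_eval_apply_mul_cexp_pairingC hβ hμ φ hφ, mul_div_cancel_left₀ _ hl]

theorem continuous_schwartzL2Pairing (f : 𝓢(ℝ, ℂ)) : Continuous (schwartzL2Pairing f) := by
  have h : schwartzL2Pairing f = fun g => _ := funext (schwartzL2Pairing_eq_inner f)
  rw [h]
  fun_prop

/-- Both sides are continuous in `η`, so the formula extends from `𝒮_d(ℝ)` by density. -/
theorem sTransform_l2Pairing (hβ : 0 < β) (hμ : IsMittagLefflerMeasure β μ)
    (φ : SchwartzVecC d) (hφ : ∀ k, mittagLeffler β (schwartzSelfPairing (φ k) / 2) ≠ 0)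
    (η : L2Vec d) :
    sTransform μ (fun ω => ((l2Pairing μ η ω : ℝ) : ℂ)) φ
      = ∑ k, sCoefficient β (φ k) * schwartzL2Pairing (φ k) (η k) := by
  obtain ⟨ψ, hψ⟩ : ∃ ψ : ℕ → SchwartzVec d, Tendsto (fun n => schwartzToL2 (ψ n)) atTop (𝓝 η) := by
    obtain ⟨x, hx, hlim⟩ := mem_closure_iff_seq_limit.1 (denseRange_schwartzToL2 d η)
    choose ψ hψ using hx
    exact ⟨ψ, by simpa only [hψ] using hlim⟩
  obtain ⟨hX, hXlim⟩ := isL2Pairing_l2Pairing hβ hμ η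
  have hr : Tendsto (fun n => ∑ k, sCoefficient β (φ k)
      * schwartzL2Pairing (φ k) (schwartzInclL2 (ψ n k))) atTop
      (𝓝 (∑ k, sCoefficient β (φ k) * schwartzL2Pairing (φ k) (η k))) := by
    refine tendsto_finsetSum _ fun k _ => Tendsto.const_mul _ ?_
    have hk : Tendsto (fun n => schwartzInclL2 (ψ n k)) atTop (𝓝 (η k)) :=
      ((PiLp.continuous_apply 2 _ k).tendsto η).comp hψ
    exact ((continuous_schwartzL2Pairing (φ k)).tendsto _).comp hk
  refine tendsto_nhds_unique ?_ hr
  simp only [← sTransform_pairing hβ hμ φ hφ, sTransform, dualPairing]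
  have hn := memLp_normalizedExp hβ hμ φ
  refine tendsto_integral_of_L1' _ (hX.ofReal.integrable_mul hn).aestronglyMeasurable
    (Eventually.of_forall fun n => (memLp_pairing hβ hμ (ψ n)).ofReal.integrable_mul hn) ?_
  have hbound := ENNReal.Tendsto.mul_const (b := eLpNorm (normalizedExp μ φ) 2 (prodMeasure d μ))
    (hXlim ψ hψ) (Or.inr hn.eLpNorm_ne_top)
  rw [zero_mul] at hbound
  refine tendsto_of_tendsto_of_tendsto_of_le_of_le tendsto_const_nhds hbound
    (fun _ => bot_le) fun n => ?_
  -- Hölder's inequality bounds the `L¹` distance by the product of the `L²` norms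
  have hle := eLpNorm_le_eLpNorm_mul_eLpNorm'_of_norm (p := 2) (q := 2) (r := 1)
    ((memLp_pairing hβ hμ (ψ n)).sub hX).aestronglyMeasurable hn.aestronglyMeasurable
    (fun (x : ℝ) (y : ℂ) => (x : ℂ) * y) 1
    (Eventually.of_forall fun ω => by
      rw [norm_mul, Complex.norm_real, NNReal.coe_one, one_mul])
  rw [ENNReal.coe_one, one_mul] at hle
  refine le_trans (le_of_eq (congrArg (fun f => eLpNorm f 1 _) ?_)) hle
  ext ω
  simp only [Pi.sub_apply, Pi.mul_apply, Complex.ofReal_sub, sub_mul]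
  rfl

theorem schwartzL2Pairing_zero (f : 𝓢(ℝ, ℂ)) : schwartzL2Pairing f 0 = 0 := by
  simp [schwartzL2Pairing_eq_inner]

theorem continuous_schwartzSelfPairing : Continuous schwartzSelfPairing := by
  have hre : Continuous fun f : 𝓢(ℝ, ℂ) => schwartzInclL2 (schwartzRe f) :=
    schwartzInclL2.continuous.comp (SchwartzMap.postcompCLM Complex.reCLM).continuous
  have him : Continuous fun f : 𝓢(ℝ, ℂ) => schwartzInclL2 (schwartzIm f) :=
    schwartzInclL2.continuous.comp (SchwartzMap.postcompCLM Complex.imCLM).continuous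
  have h : schwartzSelfPairing = fun f => _ := funext schwartzSelfPairing_eq_inner
  rw [h]
  fun_prop

theorem eventually_mittagLeffler_ne_zero (hβ : 0 < β) :
    ∀ᶠ φ : SchwartzVecC d in 𝓝 0, ∀ k, mittagLeffler β (schwartzSelfPairing (φ k) / 2) ≠ 0 := by
  refine eventually_all.2 fun k => ?_
  have hc : Continuous fun φ : SchwartzVecC d => mittagLeffler β (schwartzSelfPairing (φ k) / 2) :=
    (differentiable_mittagLeffler hβ).continuous.comp
      ((continuous_schwartzSelfPairing.comp (continuous_apply k)).div_const 2)
  refine hc.continuousAt.eventually_ne ?_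
  simp [schwartzSelfPairing, mittagLeffler_zero]

end ProductMeasure

end MittagLefflerAnalysis

end

theorem mainTheorem11 (d : ℕ) (β : ℝ) (hβ₀ : 0 < β) (hβ₁ : β ≤ 1)
    (μ : Measure MittagLefflerAnalysis.RealTempered)
    (hμ : MittagLefflerAnalysis.IsMittagLefflerMeasure β μ) :
    (∀ η : MittagLefflerAnalysis.L2Vec d,
      MittagLefflerAnalysis.IsL2Pairing μ η (MittagLefflerAnalysis.l2Pairing μ η)) ∧
    ∃ U ∈ 𝓝 (0 : MittagLefflerAnalysis.SchwartzVecC d),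
      (∀ φ ∈ U,
        MittagLefflerAnalysis.laplace μ φ ≠ 0 ∧
        MemLp (MittagLefflerAnalysis.normalizedExp μ φ) 2
          (MittagLefflerAnalysis.prodMeasure d μ) ∧
        ∀ k, MittagLefflerAnalysis.mittagLeffler β
          (MittagLefflerAnalysis.schwartzSelfPairing (φ k) / 2) ≠ 0) ∧
      ∀ η : MittagLefflerAnalysis.L2Vec d, ∀ φ ∈ U,
        MittagLefflerAnalysis.sTransform μ
            (fun ω => ((MittagLefflerAnalysis.l2Pairing μ η ω : ℝ) : ℂ)) φ
          = ∑ k, MittagLefflerAnalysis.sCoefficient β (φ k)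
              * MittagLefflerAnalysis.schwartzL2Pairing (φ k) (η k) ∧
        MittagLefflerAnalysis.sTransformVec μ
            (fun ω k => ((MittagLefflerAnalysis.randomVector μ η ω k : ℝ) : ℂ)) φ
          = ∑ k, (MittagLefflerAnalysis.sCoefficient β (φ k)
              * MittagLefflerAnalysis.schwartzL2Pairing (φ k) (η k))
                • (Pi.single k 1 : Fin d → ℂ) := by
  open MittagLefflerAnalysis in
  refine ⟨isL2Pairing_l2Pairing hβ₀ hμ, _, eventually_mittagLeffler_ne_zero hβ₀,
    fun φ hφ => ⟨?_, memLp_normalizedExp hβ₀ hμ φ, hφ⟩,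
    fun η φ hφ => ⟨sTransform_l2Pairing hβ₀ hμ φ hφ η, ?_⟩⟩
  · rw [laplace_eq_prod hβ₀ hμ]
    exact Finset.prod_ne_zero_iff.2 fun k _ => hφ k
  · ext k
    -- the `k`-th component is the first formula at `η_k 𝐞_k`, where one summand survives
    have h := sTransform_l2Pairing hβ₀ hμ φ hφ (l2Single k (η k))
    rw [Finset.sum_eq_single k (fun j _ hj => by
      rw [l2Single, PiLp.toLp_apply, Pi.single_eq_of_ne hj, schwartzL2Pairing_zero, mul_zero])
      (by simp)] at h
    simp only [l2Single, PiLp.toLp_apply, Pi.single_eq_same] at h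
    simp only [sTransformVec, randomVector, Finset.sum_apply, Pi.smul_apply, smul_eq_mul,
      Pi.single_apply, mul_ite, mul_one, mul_zero, Finset.sum_ite_eq, Finset.mem_univ, if_true]
    exact h
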